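/- **Proposition 3.2 (Variation diminishing property).** Let $\mathbb S^1=\mathbb R\ (\mathrm{mod}\ 2\pi)$ with its arc length measure of total mass $2\pi$. For an integer $n\ge 0$ and $j=0,\dots,2n$ put $$C_{j,n}(u)=\frac{2^{2n}}{2\pi\binom{2n}{n}}\left(\frac{1+\cos\left(u-\frac{2\pi j}{2n+1}\right)}{2}\right)^n,\qquad R_{j,n}=\left[\tfrac{\pi(2j-1)}{2n+1},\tfrac{\pi(2j+1)}{2n+1}\right)\subset\mathbb S^1,$$ and, for integrable $f:\mathbb S^1\to\mathbb R$, let $$T_nf=\sum_{j=0}^{2n}\left(\int_{R_{j,n}}f(u)\,du\right)C_{j,n}.$$ For a finite real sequence $x=(x_1,\dots,x_m)$ let $v(x)$ be the number of sign changes (from positive to negative or vice versa) in $x$, zero terms being ignored. Let the cyclic variation of $x$ be $\mathring v(x)=v(x_i,x_{i+1},\dots,x_m,x_1,\dots,x_{i-1},x_i)$ for any $i$ with $x_i\neq0$ (the value does not depend on $i$), and $\mathring v(x)=0$ if $x=0$. For $g:\mathbb S^1\to\mathbb R$ let $$\mathring v(g)=\sup\left\{\mathring v(g(x_1),\dots,g(x_m))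 : 0\le x_1<x_2<\dots<x_m<2\pi,\ m\ge2\right\}\in\{0,1,2,\dots\}\cup\{\infty\}.$$ Let $n\ge 0$ and let $f$ be a probability density on $\mathbb S^1$ with respect to arc length (that is, $f\ge 0$, $f$ is integrable and $\int_{\mathbb S^1} f(u)\,du=1$) whose restriction to each arc $R_{j,n}$, $j=0,\dots,2n$, is continuous. Then $$\mathring v(T_nf-\alpha)\le\mathring v(f-\alpha)\qquad\text{for all }\alpha>0.$$ -/

import Mathlib

open MeasureTheory

noncomputable section

namespace DVP

/-- The circle `𝕊¹ = ℝ (mod 2π)`, with its Lebesgue (arc length) measure of total mass `2π`. -/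
abbrev Circ : Type := AddCircle (2 * Real.pi)

instance fact_two_pi_pos : Fact (0 < 2 * Real.pi) := ⟨Real.two_pi_pos⟩

/-- The cosine as a function on the circle. -/
def cosC : Circ → ℝ := Real.cos_periodic.lift

/-- The De la Vallée Poussin basis densities
`C_{j,n}(u) = 2^{2n} / (2π binom(2n,n)) * ((1 + cos (u - 2πj/(2n+1))) / 2)^n`. -/
def basisDensity (n j : ℕ) (u : Circ) : ℝ :=
  2 ^ (2 * n) / (2 * Real.pi * ((2 * n).choose n : ℝ)) *
    ((1 + cosC (u - ((2 * Real.pi * j / (2 * n + 1) : ℝ) : Circ))) / 2) ^ n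

theorem basisDensity_coe (n j : ℕ) (x : ℝ) :
    basisDensity n j (x : Circ) = 2 ^ (2 * n) / (2 * Real.pi * ((2 * n).choose n : ℝ)) *
      ((1 + Real.cos (x - 2 * Real.pi * j / (2 * n + 1))) / 2) ^ n := rfl

/-- The arc `R_{j,n} = [π(2j-1)/(2n+1), π(2j+1)/(2n+1))` of the circle. -/
def arc (n j : ℕ) : Set Circ :=
  (fun x : ℝ => (x : Circ)) ''
    Set.Ico (Real.pi * (2 * j - 1) / (2 * n + 1)) (Real.pi * (2 * j + 1) / (2 * n + 1))

/-- The operator `T_n f = ∑_{j=0}^{2n} (∫_{R_{j,n}} f(u) du) C_{j,n}`. -/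
def T (n : ℕ) (f : Circ → ℝ) (u : Circ) : ℝ :=
  ∑ j ∈ Finset.range (2 * n + 1), (∫ w in arc n j, f w) * basisDensity n j u

/-- Probability densities on the circle with respect to arc length. -/
structure IsDensity (f : Circ → ℝ) : Prop where
  nonneg : ∀ u, 0 ≤ f u
  integrable : Integrable f
  integral_eq_one : ∫ u, f u = 1

/-- The number `v(x)` of sign changes of a finite sequence: after deletion of the zero terms,
the number of pairs of consecutive terms of opposite signs. -/
def signChanges (x : List ℝ) : ℕ :=
  ((x.filter (fun t => t ≠ 0)).zip (x.filter (fun t => t ≠ 0)).tail).countP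
    (fun p => p.1 * p.2 < 0)

/-- The cyclic variation of a finite sequence: it is
`v(x_i, x_{i+1}, …, x_m, x_1, …, x_{i-1}, x_i)`, where `x_i ≠ 0`, and `0` if all terms vanish.
The first nonzero term is used here as `x_i`; see `cyclicVariation_eq` for the independence
of this choice. -/
def cyclicVariation (x : List ℝ) : ℕ :=
  if h : x.findIdx (fun t => t ≠ 0) < x.length then
    signChanges (x.rotate (x.findIdx (fun t => t ≠ 0)) ++ [x[x.findIdx (fun t => t ≠ 0)]])
  else 0

theorem zip_tail_countP_append (p : ℝ × ℝ → Bool) (l₁ l₂ : List ℝ) (c : ℝ) :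
    ((l₁ ++ c :: l₂).zip (l₁ ++ c :: l₂).tail).countP p =
      ((l₁ ++ [c]).zip (l₁ ++ [c]).tail).countP p + ((c :: l₂).zip l₂).countP p := by
  induction l₁ with
  | nil => simp
  | cons a t ih =>
    cases t with
    | nil => simp [List.countP_cons, add_comm]
    | cons b t =>
      simp only [List.cons_append, List.tail_cons, List.zip_cons_cons, List.countP_cons] at ih ⊢
      omega

theorem signChanges_append (l₁ l₂ : List ℝ) {c : ℝ} (hc : c ≠ 0) :
    signChanges (l₁ ++ c :: l₂) = signChanges (l₁ ++ [c]) + signChanges (c :: l₂) := by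
  have := zip_tail_countP_append (fun p => p.1 * p.2 < 0) (l₁.filter (fun t => t ≠ 0))
    (l₂.filter (fun t => t ≠ 0)) c
  simpa [signChanges, List.filter_append, List.filter_cons, hc] using this

theorem signChanges_rotate_aux (x : List ℝ) {i j : ℕ} (hij : i < j) (hj : j < x.length)
    (hxi : x[i]'(hij.trans hj) ≠ 0) (hxj : x[j] ≠ 0) :
    signChanges (x.rotate i ++ [x[i]'(hij.trans hj)]) = signChanges (x.rotate j ++ [x[j]]) := by
  obtain ⟨p, q, r, a, b, rfl, rfl, rfl⟩ : ∃ p q r : List ℝ, ∃ a b : ℝ,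
      x = p ++ a :: (q ++ b :: r) ∧ i = p.length ∧ j = p.length + 1 + q.length := by
    refine ⟨x.take i, (x.drop (i + 1)).take (j - i - 1), x.drop (j + 1), x[i], x[j], ?_, ?_, ?_⟩
    · have h1 : x.drop (i + 1) =
          (x.drop (i + 1)).take (j - i - 1) ++ x[j] :: x.drop (j + 1) := by
        conv_lhs => rw [← List.take_append_drop (j - i - 1) (x.drop (i + 1))]
        rw [List.drop_drop, show i + 1 + (j - i - 1) = j by omega, ← List.drop_eq_getElem_cons hj]
      rw [← h1, ← List.drop_eq_getElem_cons, List.take_append_drop]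
    · simp; omega
    · simp; omega
  have ha : (p ++ a :: (q ++ b :: r))[p.length]'(hij.trans hj) = a := by simp
  have e : p ++ a :: (q ++ b :: r) = (p ++ a :: q) ++ b :: r := by simp
  have hb : (p ++ a :: (q ++ b :: r))[p.length + 1 + q.length]'hj = b := by
    simp only [e]
    rw [List.getElem_append_right (by simp; omega)]
    simp [show p.length + 1 + q.length - (p.length + (q.length + 1)) = 0 by omega]
  rw [ha] at hxi ⊢
  rw [hb] at hxj ⊢
  have r1 : (p ++ a :: (q ++ b :: r)).rotate p.length = a :: (q ++ b :: r) ++ p :=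
    List.rotate_append_length_eq _ _
  have r2 : (p ++ a :: (q ++ b :: r)).rotate (p.length + 1 + q.length) =
      b :: r ++ (p ++ a :: q) := by
    rw [e, show p.length + 1 + q.length = (p ++ a :: q).length by simp; omega]
    exact List.rotate_append_length_eq _ _
  rw [r1, r2]
  have s1 := signChanges_append (a :: q) (r ++ p ++ [a]) hxj
  have s2 := signChanges_append (b :: (r ++ p)) (q ++ [b]) hxi
  simp only [List.cons_append, List.append_assoc] at s1 s2 ⊢
  rw [s1, s2, add_comm]

theorem cyclicVariation_eq (x : List ℝ) {i : ℕ} (hi : i < x.length) (hxi : x[i] ≠ 0) :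
    cyclicVariation x = signChanges (x.rotate i ++ [x[i]]) := by
  have h : x.findIdx (fun t => t ≠ 0) < x.length :=
    List.findIdx_lt_length_of_exists ⟨x[i], List.getElem_mem hi, by simpa using hxi⟩
  have h0 : x[x.findIdx (fun t => t ≠ 0)] ≠ 0 := by
    simpa using List.findIdx_getElem (w := h)
  rw [cyclicVariation, dif_pos h]
  rcases lt_trichotomy (x.findIdx (fun t => t ≠ 0)) i with hlt | heq | hgt
  · exact signChanges_rotate_aux x hlt hi h0 hxi
  · simp only [heq]
  · exact (signChanges_rotate_aux x hgt h hxi h0).symm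

theorem cyclicVariation_of_forall_eq_zero (x : List ℝ) (hx : ∀ t ∈ x, t = 0) :
    cyclicVariation x = 0 := by
  rw [cyclicVariation, dif_neg]
  rw [List.findIdx_lt_length]
  rintro ⟨t, ht, h⟩
  exact absurd (hx t ht) (by simpa using h)

/-- The cyclic variation of a function on the circle: the supremum, possibly `⊤`, of the cyclic
variations of `(f(x_1), …, f(x_m))` over `0 ≤ x_1 < x_2 < ⋯ < x_m < 2π` and `m ≥ 2`. -/
def cycVar (f : Circ → ℝ) : ℕ∞ :=
  ⨆ (m : ℕ) (_ : 2 ≤ m) (x : Fin m → ℝ) (_ : StrictMono x)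
    (_ : ∀ i, x i ∈ Set.Ico 0 (2 * Real.pi)),
    (cyclicVariation (List.ofFn fun i => f (x i : Circ)) : ℕ∞)

end DVP

end

/-!
Put `N = 2n + 1` and `t j = 2πj / N`. Since `f` is continuous on each arc, the mean value theorem
(`exists_setIntegral_arc_eq`) gives `v j` in the `j`-th arc with `∫ f = (2π / N) f (v j)` over it.
The densities `C_{j,n}` sum to `N / (2π)` (`sum_cos_pow`), so `T n f - α` is a positive multiple of
`∑ j, b j * cos ((u - t j) / 2) ^ (2n)` with `b j = f (v j) - α` (`T_sub_eq`). The sequence `b`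
samples `f - α` at points in cyclic order, whence its cyclic variation is at most that of `f - α`
(`cyclicVariation_arcs_le_cycVar`). It remains to bound the cyclic variation of the trigonometric
sum by that of `b`.

This is Sylvester's theorem on a binary form `F = ∑ j, b j * L_j ^ m` that is a sum of powers of
real linear forms, restricted to the unit circle (`not_alternates_cosForm`). The signs of `b` are
those of a product of linear forms evaluated at the `t j`, one factor for each sign change
(`exists_cuts`). Each factor has the form `t ↦ cos ((s - t) / 2)`. The polar derivative of `F`
at `s` is again a sum of powers, of degree `m - 1`, with coefficients `b j * cos ((s - t j) / 2)`
up to a positive constant, so that one factor of the product is absorbed. On the other hand the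
polar derivative is, up to a positive factor and sign, the derivative of the quotient of `F` by the
`m`-th power of the form vanishing at `s`; by Rolle's theorem on the projective line minus that point it loses at most one alternation of
signs (`Alternates.polar`). Once all factors are used, the coefficients are nonnegative and the
degree is even, so the form has no sign changes left.

Alternations are recorded on a half-open period `[s, s + 2π)`. Because a form of degree `m` changes
by `(-1) ^ m` along a period, the place `s` where the circle is cut may be moved freely when the
number of alternations has the parity of `m` (`Alternates.rotate`).
-/

namespace DVP

/-! ### Sign changes and cyclic variation of finite sequences -/

theorem signChanges_zero_cons (l : List ℝ) : signChanges (0 :: l) = signChanges l := by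
  simp [signChanges]

theorem signChanges_cons_cons {a b : ℝ} (ha : a ≠ 0) (hb : b ≠ 0) (l : List ℝ) :
    signChanges (a :: b :: l) = (if a * b < 0 then 1 else 0) + signChanges (b :: l) := by
  simp [signChanges, ha, hb, List.countP_cons, add_comm]

theorem signChanges_cons_zero_cons (a : ℝ) (l : List ℝ) :
    signChanges (a :: 0 :: l) = signChanges (a :: l) := by
  simp [signChanges, List.filter_cons]

theorem signChanges_singleton (a : ℝ) : signChanges [a] = 0 := by
  by_cases ha : a = 0 <;> simp [signChanges, ha]

theorem signChanges_append_zero (l : List ℝ) : signChanges (l ++ [0]) = signChanges l := by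
  simp [signChanges, List.filter_append]

/-- The parity of the number of sign changes records whether the two ends have equal signs. -/
theorem even_signChanges_iff {b : ℝ} (hb : b ≠ 0) (l : List ℝ) {a : ℝ} (ha : a ≠ 0) :
    Even (signChanges (a :: (l ++ [b]))) ↔ 0 < a * b := by
  induction l generalizing a with
  | nil =>
    rw [List.nil_append, signChanges_cons_cons ha hb, signChanges_singleton]
    have := mul_ne_zero ha hb
    split_ifs with h
    · simp [h.le]
    · simpa using lt_of_le_of_ne (not_lt.1 h) this.symm
  | cons c l ih =>
    by_cases hc : c = 0
    · rw [hc, List.cons_append, signChanges_cons_zero_cons, ih ha]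
    · rw [List.cons_append, signChanges_cons_cons ha hc, Nat.even_add, ih hc]
      rcases ha.lt_or_gt with ha | ha <;> rcases hb.lt_or_gt with hb | hb <;>
        rcases Ne.lt_or_gt hc with hc | hc <;>
        simp [mul_pos_iff, mul_neg_iff, ha, hb, hc, ha.not_gt, hb.not_gt, hc.not_gt]

theorem signChanges_append_singleton_bounds (b : ℝ) (l : List ℝ) :
    signChanges l ≤ signChanges (l ++ [b]) ∧ signChanges (l ++ [b]) ≤ signChanges l + 1 := by
  by_cases hb : b = 0
  · simp [hb, signChanges_append_zero]
  induction l with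
  | nil => simp [signChanges_singleton, show signChanges [] = 0 from rfl]
  | cons a l ih =>
    by_cases ha : a = 0
    · simpa [ha, signChanges_zero_cons] using ih
    clear ih
    induction l generalizing a with
    | nil =>
      rw [List.singleton_append, signChanges_cons_cons ha hb, signChanges_singleton,
        signChanges_singleton]
      split_ifs <;> simp
    | cons c l ih =>
      by_cases hc : c = 0
      · simpa [hc, signChanges_cons_zero_cons] using ih a ha
      · have := ih c hc
        simp only [List.cons_append] at this ⊢
        rw [signChanges_cons_cons ha hc, signChanges_cons_cons ha hc]
        omega

theorem cyclicVariation_cons {a : ℝ} (ha : a ≠ 0) (l : List ℝ) :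
    cyclicVariation (a :: l) = signChanges (a :: (l ++ [a])) := by
  rw [cyclicVariation_eq (a :: l) (i := 0) (by simp) (by simpa using ha)]
  simp

/-- The cyclic variation does not change under a cyclic shift by one place. -/
theorem cyclicVariation_append_singleton (a : ℝ) (l : List ℝ) :
    cyclicVariation (l ++ [a]) = cyclicVariation (a :: l) := by
  by_cases h : ∀ t ∈ l, t = 0
  · by_cases ha : a = 0
    · rw [cyclicVariation_of_forall_eq_zero, cyclicVariation_of_forall_eq_zero] <;>
        simpa [ha, or_imp, forall_and] using h
    · rw [cyclicVariation_cons ha, cyclicVariation_eq (l ++ [a]) (i := l.length) (by simp)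
        (by simpa using ha), List.rotate_append_length_eq]
      simp
  · push Not at h
    obtain ⟨t, ht, h0⟩ := h
    obtain ⟨i, hi, rfl⟩ := List.getElem_of_mem ht
    rw [cyclicVariation_eq (a :: l) (i := i + 1) (by simpa using hi) (by simpa using h0),
      cyclicVariation_eq (l ++ [a]) (i := i) (by simp; omega)
        (by simpa [List.getElem_append_left hi] using h0), List.rotate_cons_succ]
    simp [List.getElem_append_left hi]

theorem cyclicVariation_zero_cons (l : List ℝ) :
    cyclicVariation (0 :: l) = cyclicVariation l := by
  by_cases h : ∀ t ∈ l, t = 0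
  · rw [cyclicVariation_of_forall_eq_zero _ h, cyclicVariation_of_forall_eq_zero]
    simpa using h
  · push Not at h
    obtain ⟨t, ht, h0⟩ := h
    obtain ⟨i, hi, rfl⟩ := List.getElem_of_mem ht
    rw [cyclicVariation_eq (0 :: l) (i := i + 1) (by simpa using hi) (by simpa using h0),
      cyclicVariation_eq l hi h0, List.rotate_cons_succ,
      List.rotate_eq_drop_append_take (by simp; omega), List.rotate_eq_drop_append_take hi.le,
      List.drop_append_of_le_length hi.le, List.take_append_of_le_length hi.le]
    simp [signChanges, List.filter_append]

/-- The cyclic variation is the number of sign changes rounded up to an even number. -/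
theorem cyclicVariation_eq_signChanges (x : List ℝ) :
    cyclicVariation x = signChanges x + signChanges x % 2 := by
  induction x with
  | nil => simp [cyclicVariation, signChanges]
  | cons a l ih =>
    by_cases ha : a = 0
    · rw [ha, cyclicVariation_zero_cons, signChanges_zero_cons, ih]
    · have h1 := (even_signChanges_iff ha l ha).2 (mul_self_pos.2 ha)
      have h2 := signChanges_append_singleton_bounds a (a :: l)
      rw [List.cons_append] at h2
      rw [cyclicVariation_cons ha]
      rw [Nat.even_iff] at h1
      omega

theorem even_cyclicVariation (x : List ℝ) : Even (cyclicVariation x) := by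
  rw [cyclicVariation_eq_signChanges, Nat.even_iff]
  omega

/-- If `a` starts the list, the alternating points can be chosen to start with `a` as well. -/
theorem exists_alternating_sublist_cons (g : ℝ → ℝ) (l : List ℝ) {a : ℝ} (ha : g a ≠ 0) :
    ∃ l' : List ℝ, l'.Sublist l ∧ l'.length = signChanges ((a :: l).map g) ∧
      (a :: l').IsChain (fun x y => g x * g y < 0) := by
  induction l generalizing a with
  | nil => exact ⟨[], by simp [signChanges_singleton]⟩
  | cons b l ih =>
    by_cases hb : g b = 0
    · obtain ⟨l', h1, h2, h3⟩ := ih ha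
      refine ⟨l', h1.cons _, ?_, h3⟩
      simpa [hb, signChanges_cons_zero_cons] using h2
    · obtain ⟨l', h1, h2, h3⟩ := ih hb
      simp only [List.map_cons] at h2 ⊢
      rw [signChanges_cons_cons ha hb]
      by_cases hab : g a * g b < 0
      · refine ⟨b :: l', h1.cons_cons _, ?_, List.isChain_cons_cons.2 ⟨hab, h3⟩⟩
        rw [if_pos hab, List.length_cons, h2, add_comm]
      · refine ⟨l', h1.cons _, by rw [if_neg hab, h2, zero_add], ?_⟩
        have hab' : 0 < g a * g b := lt_of_le_of_ne (not_lt.1 hab) (mul_ne_zero ha hb).symm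
        rw [List.isChain_cons] at h3 ⊢
        refine ⟨fun y hy => ?_, h3.2⟩
        have := h3.1 y hy
        rcases Ne.lt_or_gt ha with ha | ha <;> rcases Ne.lt_or_gt hb with hb | hb <;>
          simp_all [mul_pos_iff, mul_neg_iff, ha.not_gt, hb.not_gt]

/-- A list at which `g` has `c > 0` sign changes contains `c + 1` points of alternating signs. -/
theorem exists_alternating_sublist (g : ℝ → ℝ) (l : List ℝ) (h : 0 < signChanges (l.map g)) :
    ∃ l' : List ℝ, l'.Sublist l ∧ l'.length = signChanges (l.map g) + 1 ∧
      l'.IsChain (fun x y => g x * g y < 0) := by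
  induction l with
  | nil => simp [signChanges] at h
  | cons a l ih =>
    by_cases ha : g a = 0
    · rw [List.map_cons, ha, signChanges_zero_cons] at h ⊢
      obtain ⟨l', h1, h2⟩ := ih h
      exact ⟨l', h1.cons _, h2⟩
    · obtain ⟨l', h1, h2, h3⟩ := exists_alternating_sublist_cons g l ha
      exact ⟨a :: l', h1.cons_cons _, by simpa using h2, h3⟩

/-! ### Cuts between sign changes -/

/-- For a sorted list of pairs `(t, b)` with all `b` nonzero, the sign pattern of the `b` is that
of a product of half-angle sines vanishing once between any two neighbours of opposite signs. -/
theorem exists_cuts_of_ne_zero {A : ℝ} (l : List (ℝ × ℝ)) (t b : ℝ)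
    (hb : ∀ q ∈ (t, b) :: l, q.2 ≠ 0)
    (hl : ((t, b) :: l).Pairwise (fun q r => q.1 < r.1))
    (hA : ∀ q ∈ (t, b) :: l, q.1 ∈ Set.Ico A (A + 2 * Real.pi)) :
    ∃ S : List ℝ, S.length = signChanges (((t, b) :: l).map Prod.snd) ∧
      (∀ s ∈ S, t < s ∧ s < A + 2 * Real.pi) ∧
      ∀ q ∈ (t, b) :: l, 0 ≤ b * q.2 * (S.map fun s => Real.sin ((s - q.1) / 2)).prod := by
  induction l generalizing t b with
  | nil =>
    refine ⟨[], by simp [signChanges_singleton], by simp, ?_⟩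
    simpa using mul_self_nonneg b
  | cons r l ih =>
    obtain ⟨t₁, b₁⟩ := r
    have hl' := List.pairwise_cons.1 hl
    have htt : t < t₁ := hl'.1 (t₁, b₁) (by simp)
    have hb0 : b ≠ 0 := hb (t, b) (by simp)
    have hb1 : b₁ ≠ 0 := hb (t₁, b₁) (by simp)
    have ht : t ∈ Set.Ico A (A + 2 * Real.pi) := hA (t, b) (by simp)
    have ht1 : t₁ ∈ Set.Ico A (A + 2 * Real.pi) := hA (t₁, b₁) (by simp)
    have hpos : ∀ S : List ℝ, (∀ s ∈ S, t < s ∧ s < A + 2 * Real.pi) →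
        0 ≤ b * b * (S.map fun s => Real.sin ((s - t) / 2)).prod := by
      intro S hS
      refine mul_nonneg (mul_self_nonneg b) (List.prod_nonneg ?_)
      intro y hy
      obtain ⟨s, hs, rfl⟩ := List.mem_map.1 hy
      have := hS s hs
      exact Real.sin_nonneg_of_nonneg_of_le_pi (by linarith) (by linarith [ht.1])
    obtain ⟨S, h1, h2, h3⟩ := ih t₁ b₁ (fun q hq => hb q (by simp_all)) hl'.2
      (fun q hq => hA q (by simp_all))
    have h2' : ∀ s ∈ S, t < s ∧ s < A + 2 * Real.pi :=
      fun s hs => ⟨htt.trans (h2 s hs).1, (h2 s hs).2⟩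
    simp only [List.map_cons] at h1 ⊢
    rw [signChanges_cons_cons hb0 hb1]
    by_cases hbb : b * b₁ < 0
    · have h4 : ∀ s ∈ (t + t₁) / 2 :: S, t < s ∧ s < A + 2 * Real.pi := by
        intro s hs
        rcases List.mem_cons.1 hs with rfl | hs
        · constructor <;> linarith [ht1.2]
        · exact h2' s hs
      refine ⟨(t + t₁) / 2 :: S, by rw [List.length_cons, h1, if_pos hbb, add_comm], h4, ?_⟩
      intro q hq
      rcases List.mem_cons.1 hq with rfl | hq
      · exact hpos _ h4
      · have hq1 : t₁ ≤ q.1 := by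
          rcases List.mem_cons.1 hq with rfl | hq
          · exact le_rfl
          · exact ((List.pairwise_cons.1 hl'.2).1 q hq).le
        have hqA := hA q (List.mem_cons_of_mem _ hq)
        have hs : Real.sin (((t + t₁) / 2 - q.1) / 2) ≤ 0 :=
          Real.sin_nonpos_of_nonpos_of_neg_pi_le (by linarith)
            (by linarith [hqA.2, ht.1])
        rw [List.map_cons, List.prod_cons]
        have h5 := mul_nonneg (h3 q hq) (mul_nonneg_of_nonpos_of_nonpos hbb.le hs)
        refine (mul_nonneg_iff_of_pos_right (mul_self_pos.2 hb1)).1 ?_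
        linarith
    · refine ⟨S, by rw [h1, if_neg hbb, zero_add], h2', ?_⟩
      intro q hq
      rcases List.mem_cons.1 hq with rfl | hq
      · exact hpos _ h2'
      · have h5 := mul_nonneg (h3 q hq) (not_lt.1 hbb)
        refine (mul_nonneg_iff_of_pos_right (mul_self_pos.2 hb1)).1 ?_
        linarith

/-- The signs of a cyclic sequence `b` placed at increasing points `t` of the circle are those of
a product of half-angle sines with as many factors as the cyclic variation of `b`. -/
theorem exists_cuts {A : ℝ} (l : List (ℝ × ℝ)) (hl : l.Pairwise (fun q r => q.1 < r.1))
    (hA : ∀ q ∈ l, q.1 ∈ Set.Ico A (A + 2 * Real.pi)) :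
    ∃ (S : List ℝ) (e : ℝ), S.length = cyclicVariation (l.map Prod.snd) ∧ e ≠ 0 ∧
      ∀ q ∈ l, 0 ≤ e * q.2 * (S.map fun s => Real.sin ((s - q.1) / 2)).prod := by
  obtain ⟨S, e, hS, he, h⟩ : ∃ (S : List ℝ) (e : ℝ), S.length = signChanges (l.map Prod.snd) ∧
      e ≠ 0 ∧ ∀ q ∈ l, 0 ≤ e * q.2 * (S.map fun s => Real.sin ((s - q.1) / 2)).prod := by
    have hc : signChanges ((l.filter fun q => q.2 ≠ 0).map Prod.snd) =
        signChanges (l.map Prod.snd) := by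
      simp [signChanges, List.filter_map, Function.comp_def]
    have hmem : ∀ q ∈ l.filter (fun q => q.2 ≠ 0), q.2 ≠ 0 ∧ q ∈ l := by
      intro q hq
      simpa [and_comm] using List.mem_filter.1 hq
    have hmem' : ∀ q ∈ l, q.2 ≠ 0 → q ∈ l.filter (fun q => q.2 ≠ 0) := by
      intro q hq h
      simpa using ⟨hq, h⟩
    rw [← hc]
    have hp := hl.filter (fun q => q.2 ≠ 0)
    generalize l.filter (fun q => q.2 ≠ 0) = L at hmem hmem' hp
    cases L with
    | nil =>
      refine ⟨[], 1, by simp [signChanges], one_ne_zero, fun q hq => ?_⟩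
      by_cases h : q.2 = 0
      · simp [h]
      · simpa using hmem' q hq h
    | cons r L =>
      obtain ⟨t, b⟩ := r
      obtain ⟨S, h1, -, h3⟩ := exists_cuts_of_ne_zero L t b (fun q hq => (hmem q hq).1) hp
        (fun q hq => hA q (hmem q hq).2)
      refine ⟨S, b, h1, (hmem (t, b) (by simp)).1, fun q hq => ?_⟩
      by_cases h : q.2 = 0
      · simp [h]
      · exact h3 q (hmem' q hq h)
  rw [cyclicVariation_eq_signChanges]
  rcases Nat.mod_two_eq_zero_or_one (signChanges (l.map Prod.snd)) with h0 | h0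
  · exact ⟨S, e, by rw [hS, h0, add_zero], he, h⟩
  · -- An odd number of cuts is completed by one at the right end of the fundamental interval.
    refine ⟨(A + 2 * Real.pi) :: S, e, by rw [List.length_cons, hS, h0], he, fun q hq => ?_⟩
    have := mul_nonneg (h q hq) (Real.sin_nonneg_of_nonneg_of_le_pi
      (x := (A + 2 * Real.pi - q.1) / 2) (by linarith [(hA q hq).2]) (by linarith [(hA q hq).1]))
    rw [List.map_cons, List.prod_cons]
    linarith

/-! ### Alternation on the circle -/

/-- `p` alternates `k` times on `[s, s + 2π)`: there are `k` increasing points of this interval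
at which `p` takes nonzero values of alternating signs; `e` has the sign of the first value. -/
def Alternates (p : ℝ → ℝ) (k : ℕ) (s : ℝ) : Prop :=
  ∃ (e : ℝ) (z : ℕ → ℝ), (∀ i, i + 1 < k → z i < z (i + 1)) ∧
    (∀ i < k, z i ∈ Set.Ico s (s + 2 * Real.pi)) ∧ ∀ i < k, 0 < e * (-1) ^ i * p (z i)

/-- If `p(u + 2π) = (-1)^k p(u)`, then `k`-fold alternation does not depend on where the circle
is cut. -/
theorem Alternates.rotate {p : ℝ → ℝ} {k : ℕ} {s : ℝ} (hk : 0 < k)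
    (hp : ∀ (u : ℝ) (q : ℤ), p (u + q * (2 * Real.pi)) = ((-1) ^ k) ^ q * p u)
    (h : Alternates p k s) (s' : ℝ) : Alternates p k s' := by
  obtain ⟨e, z, hz, hs, hsign⟩ := h
  have hk' : (0 : ℤ) < k := by exact_mod_cast hk
  have hπ := Real.pi_pos
  -- The quasi-periodic extension of the `k` points to a sequence indexed by `ℤ`.
  let X : ℤ → ℝ := fun i => z (i % k).toNat + (i / k : ℤ) * (2 * Real.pi)
  have hX : ∀ (q : ℤ) (r : ℕ), r < k → X (k * q + r) = z r + q * (2 * Real.pi) := by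
    intro q r hr
    have h1 : ((k : ℤ) * q + r) % k = r := by
      rw [Int.mul_add_emod_self_left, Int.emod_eq_of_lt] <;> omega
    have h2 : ((k : ℤ) * q + r) / k = q := by
      rw [Int.mul_add_ediv_left _ _ hk'.ne', Int.ediv_eq_zero_of_lt] <;> omega
    simp only [X, h1, h2, Int.toNat_natCast]
  have hdecomp : ∀ i : ℤ, ∃ (q : ℤ) (r : ℕ), r < k ∧ i = k * q + r := by
    intro i
    have h1 := Int.emod_nonneg i hk'.ne'
    have h2 := Int.emod_lt_of_pos i hk'
    refine ⟨i / k, (i % k).toNat, by omega, ?_⟩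
    rw [Int.toNat_of_nonneg h1, Int.mul_ediv_add_emod]
  have hmono : StrictMono X := by
    refine strictMono_int_of_lt_succ fun i => ?_
    obtain ⟨q, r, hr, rfl⟩ := hdecomp i
    rw [hX q r hr]
    by_cases hr1 : r + 1 < k
    · have := hX q (r + 1) hr1
      push_cast at this
      rw [add_assoc, this]
      linarith [hz r hr1]
    · have := hX (q + 1) 0 hk
      rw [show (k : ℤ) * (q + 1) + (0 : ℕ) = k * q + r + 1 by push_cast; rw [mul_add]; omega]
        at this
      rw [this]
      have h1 := (hs r hr).2
      have h2 := (hs 0 hk).1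
      push_cast
      linarith
  have hper : ∀ i, X (i + k) = X i + 2 * Real.pi := by
    intro i
    obtain ⟨q, r, hr, rfl⟩ := hdecomp i
    rw [hX q r hr, show (k : ℤ) * q + r + k = k * (q + 1) + r by ring, hX _ r hr]
    push_cast; ring
  have hsgn : ∀ i : ℤ, 0 < e * (-1) ^ i * p (X i) := by
    intro i
    obtain ⟨q, r, hr, rfl⟩ := hdecomp i
    rw [hX q r hr, hp, zpow_add₀ (by norm_num), zpow_mul, zpow_natCast, zpow_natCast]
    have h1 : (((-1 : ℝ) ^ k) ^ q) * ((-1) ^ k) ^ q = 1 := by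
      rw [← mul_zpow, ← mul_pow]; simp
    have h2 : e * ((((-1 : ℝ) ^ k) ^ q) * (-1) ^ r) * ((((-1 : ℝ) ^ k) ^ q) * p (z r)) =
      ((((-1 : ℝ) ^ k) ^ q) * ((-1) ^ k) ^ q) * (e * (-1) ^ r * p (z r)) := by ring
    rw [h2, h1, one_mul]
    exact hsign r hr
  have hX0 : ∀ q : ℤ, X (k * q) = z 0 + q * (2 * Real.pi) := by
    intro q
    simpa using hX q 0 hk
  obtain ⟨i₀, h1, h2⟩ : ∃ i₀ : ℤ, s' ≤ X i₀ ∧ ∀ i, s' ≤ X i → i₀ ≤ i := by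
    refine Int.exists_least_of_bdd (P := fun i => s' ≤ X i) ?_ ?_
    · obtain ⟨q, hq⟩ := exists_int_lt ((s' - z 0) / (2 * Real.pi))
      refine ⟨k * q, fun i hi => hmono.le_iff_le.1 (le_trans ?_ hi)⟩
      rw [hX0]
      rw [lt_div_iff₀ (by positivity)] at hq
      linarith
    · obtain ⟨q, hq⟩ := exists_int_gt ((s' - z 0) / (2 * Real.pi))
      refine ⟨k * q, ?_⟩
      rw [hX0]
      rw [div_lt_iff₀ (by positivity)] at hq
      linarith
  refine ⟨e * (-1) ^ i₀, fun j => X (i₀ + j), fun j _ => hmono (by push_cast; omega),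
    fun j hj => ⟨h1.trans (hmono.monotone (by omega)), ?_⟩, fun j _ => ?_⟩
  · have h3 : X (i₀ - 1) < s' := by
      by_contra h
      have := h2 _ (not_lt.1 h)
      omega
    have h4 : X (i₀ + j) ≤ X (i₀ - 1 + k) := hmono.monotone (by omega)
    rw [hper] at h4
    linarith
  · have := hsgn (i₀ + j)
    rw [zpow_add₀ (by norm_num), zpow_natCast] at this
    rwa [mul_assoc e]

/-! ### Polar derivatives and Sylvester's theorem -/

/-- The trigonometric form `∑ j, b j * cos ((u - t j) / 2) ^ m`, that is the binary form
`∑ j, b j * L_j ^ m` with linear forms `L_j`, restricted to the unit circle. -/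
noncomputable def cosForm {ι : Type*} (J : Finset ι) (t b : ι → ℝ) (m : ℕ) (u : ℝ) : ℝ :=
  ∑ j ∈ J, b j * Real.cos ((u - t j) / 2) ^ m

theorem cosForm_add_int_mul {ι : Type*} (J : Finset ι) (t b : ι → ℝ) (m : ℕ) (u : ℝ) (q : ℤ) :
    cosForm J t b m (u + q * (2 * Real.pi)) = ((-1) ^ m) ^ q * cosForm J t b m u := by
  rw [cosForm, cosForm, Finset.mul_sum]
  refine Finset.sum_congr rfl fun j _ => ?_
  rw [show (u + q * (2 * Real.pi) - t j) / 2 = (u - t j) / 2 + q * Real.pi by ring,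
    Real.cos_add_int_mul_pi, mul_pow, ← zpow_natCast ((-1 : ℝ) ^ q), ← zpow_mul, mul_comm q,
    zpow_mul, zpow_natCast]
  ring

/-- The polar derivative: dividing a form of degree `m + 1` by the power of the linear form
vanishing at `s` and differentiating gives the form of degree `m` whose coefficients are
multiplied by `cos ((s - t j) / 2)`. -/
theorem hasDerivAt_cosForm_div {ι : Type*} (J : Finset ι) (t b : ι → ℝ) (m : ℕ) {s u : ℝ}
    (hu : Real.sin ((u - s) / 2) ≠ 0) :
    HasDerivAt (fun u => cosForm J t b (m + 1) u / Real.sin ((u - s) / 2) ^ (m + 1))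
      (-((m + 1) / 2 * cosForm J t (fun j => b j * Real.cos ((s - t j) / 2)) m u /
        Real.sin ((u - s) / 2) ^ (m + 2))) u := by
  have h1 : ∀ c : ℝ, HasDerivAt (fun u => (u - c) / 2) (1 / 2) u := fun c =>
    ((hasDerivAt_id u).sub_const c).div_const 2
  have h2 : HasDerivAt (fun u => cosForm J t b (m + 1) u)
      (∑ j ∈ J, b j * (((m + 1 : ℕ) : ℝ) * Real.cos ((u - t j) / 2) ^ m *
        (-Real.sin ((u - t j) / 2) * (1 / 2)))) u := by
    unfold cosForm
    refine HasDerivAt.fun_sum fun j _ => ?_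
    simpa using (((h1 (t j)).cos).fun_pow (m + 1)).const_mul (b j)
  have h3 : HasDerivAt (fun u => Real.sin ((u - s) / 2) ^ (m + 1))
      (((m + 1 : ℕ) : ℝ) * Real.sin ((u - s) / 2) ^ m * (Real.cos ((u - s) / 2) * (1 / 2))) u := by
    simpa using ((h1 s).sin).fun_pow (m + 1)
  refine (h2.fun_div h3 (pow_ne_zero _ hu)).congr_deriv (Eq.symm ?_)
  rw [← neg_div, div_eq_div_iff (pow_ne_zero _ hu) (pow_ne_zero _ (pow_ne_zero _ hu))]
  simp only [cosForm, Finset.sum_mul, Finset.mul_sum, ← Finset.sum_sub_distrib,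
    ← Finset.sum_neg_distrib]
  refine Finset.sum_congr rfl fun j _ => ?_
  have h4 : Real.cos ((s - t j) / 2) = Real.cos ((u - t j) / 2) * Real.cos ((u - s) / 2) +
      Real.sin ((u - t j) / 2) * Real.sin ((u - s) / 2) := by
    rw [← Real.cos_sub]; congr 1; ring
  rw [h4]
  push_cast
  ring

/-- Rolle's theorem on the projective line: the polar derivative loses at most one alternation. -/
theorem Alternates.polar {ι : Type*} {J : Finset ι} {t b : ι → ℝ} {m k : ℕ} {s : ℝ}
    (h : Alternates (cosForm J t b (m + 1)) (k + 1) s) :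
    Alternates (cosForm J t (fun j => b j * Real.cos ((s - t j) / 2)) m) k s := by
  obtain ⟨e, z, hz, hs, hsign⟩ := h
  have key : ∀ i : ℕ, ∃ y, i < k → z i ≤ y ∧ y < z (i + 1) ∧
      0 < e * (-1) ^ i * cosForm J t (fun j => b j * Real.cos ((s - t j) / 2)) m y := by
    intro i
    by_cases hi : i < k
    swap
    · exact ⟨0, fun h => absurd h hi⟩
    have hlt := hz i (by omega)
    have hsi := hs i (by omega)
    have hsi' := hs (i + 1) (by omega)
    have hg := hsign i (by omega)
    have hg' := hsign (i + 1) (by omega)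
    rcases hsi.1.eq_or_lt with h0 | h0
    · -- At the pole `s` itself the form and its polar derivative coincide.
      refine ⟨z i, fun _ => ⟨le_rfl, hlt, ?_⟩⟩
      convert hg using 2
      rw [← h0]
      simp only [cosForm, mul_assoc, pow_succ']
    · have hpos : ∀ u ∈ Set.Icc (z i) (z (i + 1)), 0 < Real.sin ((u - s) / 2) := fun u hu =>
        Real.sin_pos_of_pos_of_lt_pi (by linarith [hu.1]) (by linarith [hu.2, hsi'.2])
      have hd := fun u hu => hasDerivAt_cosForm_div J t b m (s := s) (u := u) (hpos u hu).ne'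
      obtain ⟨y, hy, hy'⟩ := exists_hasDerivAt_eq_slope _ _ hlt
        (fun u hu => (hd u hu).continuousAt.continuousWithinAt)
        (fun u hu => hd u (Set.Ioo_subset_Icc_self hu))
      refine ⟨y, fun _ => ⟨hy.1.le, hy.2, ?_⟩⟩
      have hl := hpos (z i) ⟨le_rfl, hlt.le⟩
      have hr := hpos (z (i + 1)) ⟨hlt.le, le_rfl⟩
      have hm := hpos y (Set.Ioo_subset_Icc_self hy)
      have h1 := div_pos hg (pow_pos hl (m + 1))
      have h2 := div_pos hg' (pow_pos hr (m + 1))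
      rw [eq_div_iff (by linarith)] at hy'
      set Q := cosForm J t (fun j => b j * Real.cos ((s - t j) / 2)) m y
      have h3 : 0 < e * (-1) ^ i * Q *
          ((m + 1) / 2 / Real.sin ((y - s) / 2) ^ (m + 2) * (z (i + 1) - z i)) := by
        have := congrArg (fun x => -(e * (-1) ^ i * x)) hy'
        refine (add_pos h1 h2).trans_eq (Eq.symm ?_)
        calc _ = -(e * (-1) ^ i * (-((m + 1) / 2 * Q / Real.sin ((y - s) / 2) ^ (m + 2)) *
              (z (i + 1) - z i))) := by ring
          _ = _ := this
          _ = _ := by ring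
      refine pos_of_mul_pos_left h3 ?_
      have : 0 < z (i + 1) - z i := by linarith
      positivity
  choose y hy using key
  refine ⟨e, y, fun i hi => ?_, fun i hi => ⟨?_, ?_⟩, fun i hi => (hy i hi).2.2⟩
  · exact (hy i (by omega)).2.1.trans_le (hy (i + 1) hi).1
  · exact (hs i (by omega)).1.trans (hy i hi).1
  · exact (hy i hi).2.1.trans (hs (i + 1) (by omega)).2

/-- Sylvester's theorem on sums of powers of linear forms: if the coefficients have the signs of a
product of `r` linear forms, the form of degree `m` does not alternate more than `r` times. The
numbers `m`, `r`, `k` have the same parity, since a form of degree `m` changes by `(-1) ^ m` along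
a period. -/
theorem not_alternates_cosForm {ι : Type*} (J : Finset ι) (t : ι → ℝ) (m : ℕ) (S : List ℝ)
    (b : ι → ℝ) (k : ℕ) (s : ℝ)
    (hS : ∀ j ∈ J, 0 ≤ b j * (S.map fun s => Real.cos ((s - t j) / 2)).prod)
    (hk : S.length + 2 ≤ k) (hmk : Even (m + k)) (hmS : Even (m + S.length)) :
    ¬ Alternates (cosForm J t b m) k s := by
  -- A form without sign changes cannot alternate twice.
  have base : ∀ (p : ℝ → ℝ) (k : ℕ) (s : ℝ), 2 ≤ k →
      ((∀ u v, 0 ≤ p u * p v)) → ¬ Alternates p k s := by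
    rintro p k s hk hp ⟨e, z, -, -, h⟩
    have h0 := h 0 (by omega)
    have h1 := h 1 (by omega)
    have h2 := mul_pos h0 h1
    have h3 := mul_nonneg (mul_self_nonneg e) (hp (z 0) (z 1))
    norm_num at h2
    linarith
  induction m generalizing S b k s with
  | zero =>
    refine base _ k s (by omega) fun u v => ?_
    simpa [cosForm] using mul_self_nonneg _
  | succ m ih =>
    intro h
    cases S with
    | nil =>
      refine base _ k s (by omega) (fun u v => ?_) h
      have : ∀ u, 0 ≤ cosForm J t b (m + 1) u := fun u =>
        Finset.sum_nonneg fun j hj => mul_nonneg (by simpa using hS j hj)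
          (Even.pow_nonneg (by simpa using hmS) _)
      exact mul_nonneg (this u) (this v)
    | cons s₀ S =>
      simp only [List.length_cons] at hk hmS
      obtain ⟨k, rfl⟩ : ∃ k', k = k' + 1 := ⟨k - 1, by omega⟩
      have hpar : (-1 : ℝ) ^ (m + 1) = (-1) ^ (k + 1) := by
        rw [Nat.even_add] at hmk
        by_cases hev : Even (m + 1)
        · rw [hev.neg_one_pow, (hmk.1 hev).neg_one_pow]
        · rw [(Nat.not_even_iff_odd.1 hev).neg_one_pow,
            (Nat.not_even_iff_odd.1 (fun h => hev (hmk.2 h))).neg_one_pow]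
      have h' := h.rotate (by omega)
        (fun u q => by rw [cosForm_add_int_mul, hpar]) s₀
      refine ih S (fun j => b j * Real.cos ((s₀ - t j) / 2)) k s₀ (fun j hj => ?_) (by omega)
        ?_ ?_ h'.polar
      · simpa [mul_assoc] using hS j hj
      · rw [Nat.even_iff] at hmk ⊢; omega
      · rw [Nat.even_iff] at hmS ⊢; omega

/-- A function whose values along increasing points of a period have cyclic variation `k`
alternates `k` times: at least `k - 1` of the sign changes lie within the list. -/
theorem alternates_cyclicVariation (p : ℝ → ℝ) (l : List ℝ) (hl : l.Pairwise (· < ·)) {s : ℝ}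
    (hs : ∀ x ∈ l, x ∈ Set.Ico s (s + 2 * Real.pi)) :
    Alternates p (cyclicVariation (l.map p)) s := by
  rw [cyclicVariation_eq_signChanges]
  rcases Nat.eq_zero_or_pos (signChanges (l.map p)) with h0 | h0
  · rw [h0]
    exact ⟨0, 0, by simp, by simp, by simp⟩
  obtain ⟨l', h1, h2, h3⟩ := exists_alternating_sublist p l h0
  have hlen : signChanges (l.map p) + signChanges (l.map p) % 2 ≤ l'.length := by omega
  generalize signChanges (l.map p) + signChanges (l.map p) % 2 = k at hlen
  have hget : ∀ i (hi : i < l'.length), l'.getD i 0 = l'[i] := fun i hi =>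
    List.getD_eq_getElem _ _ hi
  rw [List.isChain_iff_getElem] at h3
  have hpw := List.pairwise_iff_getElem.1 (hl.sublist h1)
  refine ⟨p (l'.getD 0 0), fun i => l'.getD i 0, fun i hi => ?_, fun i hi => ?_, fun i hi => ?_⟩
  · simp only [hget i (by omega), hget (i + 1) (by omega)]
    exact hpw _ _ _ _ (by omega)
  · simp only [hget i (by omega)]
    exact hs _ (h1.subset (List.getElem_mem _))
  · induction i with
    | zero =>
      have := h3 0 (by omega)
      rw [← hget 0 (by omega)] at this
      rw [pow_zero, mul_one]
      exact mul_self_pos.2 (left_ne_zero_of_mul this.ne)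
    | succ i ih =>
      have h4 := ih (by omega)
      have h5 := h3 i (by omega)
      rw [← hget i (by omega), ← hget (i + 1) (by omega)] at h5
      simp only [pow_succ]
      set a := p (l'.getD i 0)
      set c := p (l'.getD (i + 1) 0)
      have h6 := mul_pos_of_neg_of_neg h5 (neg_neg_of_pos h4)
      have h7 : a * c * -(p (l'.getD 0 0) * (-1) ^ i * a) =
        p (l'.getD 0 0) * ((-1) ^ i * -1) * c * (a * a) := by ring
      rw [h7] at h6
      exact pos_of_mul_pos_left h6 (mul_self_nonneg a)

/-! ### Integrals over arcs -/

theorem arc_length_le (n : ℕ) (j : ℕ) :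
    Real.pi * (2 * j + 1) / (2 * n + 1) ≤
      Real.pi * (2 * j - 1) / (2 * n + 1) + 2 * Real.pi := by
  have hN : (0 : ℝ) < 2 * n + 1 := by positivity
  rw [← sub_le_iff_le_add', ← sub_div, div_le_iff₀ hN]
  nlinarith [Real.pi_pos, mul_nonneg Real.pi_pos.le (Nat.cast_nonneg (α := ℝ) n)]

theorem measurableSet_arc (n j : ℕ) : MeasurableSet (arc n j) := by
  refine measurableSet_Ico.image_of_continuousOn_injOn
    (AddCircle.continuous_mk' _).continuousOn fun x hx y hy hxy => ?_
  have hle := arc_length_le n j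
  exact (AddCircle.coe_eq_coe_iff_of_mem_Ico
    ⟨hx.1, hx.2.trans_le hle⟩ ⟨hy.1, hy.2.trans_le hle⟩).1 hxy

theorem volume_arc (n j : ℕ) :
    volume (arc n j) = ENNReal.ofReal (2 * Real.pi / (2 * n + 1)) := by
  set a := Real.pi * (2 * j - 1) / (2 * n + 1) with ha
  set b := Real.pi * (2 * j + 1) / (2 * n + 1) with hb
  have hle : b ≤ a + 2 * Real.pi := arc_length_le n j
  have hmp := AddCircle.measurePreserving_mk (2 * Real.pi) a
  rw [← Measure.restrict_congr_set (Ico_ae_eq_Ioc (μ := volume))] at hmp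
  rw [← hmp.measure_preimage (measurableSet_arc n j).nullMeasurableSet,
    Measure.restrict_apply (hmp.measurable (measurableSet_arc n j))]
  have : (QuotientAddGroup.mk ⁻¹' arc n j : Set ℝ) ∩ Set.Ico a (a + 2 * Real.pi) =
      Set.Ico a b := by
    ext x
    constructor
    · rintro ⟨⟨y, hy, hxy⟩, hx⟩
      have := (AddCircle.coe_eq_coe_iff_of_mem_Ico ⟨hy.1, hy.2.trans_le hle⟩ hx).1 hxy
      exact this ▸ hy
    · exact fun hx => ⟨⟨x, hx, rfl⟩, hx.1, hx.2.trans_le hle⟩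
  rw [this, Real.volume_Ico, ha, hb, ← sub_div]
  congr 2
  ring

/-- Mean value theorem on an arc. -/
theorem exists_setIntegral_arc_eq {n j : ℕ} {f : Circ → ℝ} (hf : IntegrableOn f (arc n j))
    (hcont : ContinuousOn f (arc n j)) :
    ∃ v ∈ Set.Ico (Real.pi * (2 * j - 1) / (2 * n + 1)) (Real.pi * (2 * j + 1) / (2 * n + 1)),
      ∫ w in arc n j, f w = 2 * Real.pi / (2 * n + 1) * f (v : Circ) := by
  have hpos : 0 < 2 * Real.pi / (2 * n + 1) := by positivity
  have h0 : volume (arc n j) ≠ 0 := by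
    rw [volume_arc]; simpa using hpos
  have htop : volume (arc n j) ≠ ⊤ := by
    rw [volume_arc]; exact ENNReal.ofReal_ne_top
  obtain ⟨x, hx, hx'⟩ := exists_le_setAverage h0 htop hf
  obtain ⟨y, hy, hy'⟩ := exists_setAverage_le h0 htop hf
  have hconn : IsPreconnected (arc n j) :=
    isPreconnected_Ico.image _ (AddCircle.continuous_mk' _).continuousOn
  obtain ⟨_, ⟨v, hv, rfl⟩, hv'⟩ := hconn.intermediate_value hx hy hcont ⟨hx', hy'⟩
  refine ⟨v, hv, ?_⟩
  rw [hv', setAverage_eq, Measure.real, volume_arc, ENNReal.toReal_ofReal hpos.le, smul_eq_mul,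
    mul_inv_cancel_left₀ hpos.ne']

/-! ### The partition of unity -/

open Complex in
/-- With `w = exp (i x)` and a primitive root of unity `η`, each summand is, up to the factor
`2 ^ (2n) * w ^ n`, a sum of terms `binom(2n, k) w ^ k (η ^ (k + n + 1)) ^ j`; summation over `j`
leaves only `k = n`. -/
theorem sum_cos_pow_complex (n : ℕ) (x : ℝ) :
    ∑ j ∈ Finset.range (2 * n + 1),
      Complex.cos (((x - 2 * Real.pi * j / (2 * n + 1)) / 2 : ℝ)) ^ (2 * n) =
      (2 * n + 1) * ((2 * n).choose n : ℂ) / 2 ^ (2 * n) := by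
  have hN : (2 * n + 1 : ℕ) ≠ 0 := by omega
  have hNc : ((2 * n + 1 : ℕ) : ℂ) ≠ 0 := by exact_mod_cast hN
  have hζ := (Complex.isPrimitiveRoot_exp (2 * n + 1) hN).inv
  set η := (exp (2 * Real.pi * I / (2 * n + 1 : ℕ)))⁻¹ with hη
  set w := exp (x * I) with hw
  have hw0 : w ≠ 0 := exp_ne_zero _
  have hcos : ∀ j : ℕ, 2 ^ (2 * n) * w ^ n *
      Complex.cos (((x - 2 * Real.pi * j / (2 * n + 1)) / 2 : ℝ)) ^ (2 * n) =
      (η ^ j) ^ (n + 1) * (w * η ^ j + 1) ^ (2 * n) := by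
    intro j
    set a : ℂ := (((x - 2 * Real.pi * j / (2 * n + 1)) / 2 : ℝ) : ℂ) with ha
    have h1 : w * η ^ j = exp (a * I) ^ 2 := by
      rw [hw, hη, ← exp_neg, ← exp_nat_mul, ← exp_nat_mul, ← exp_add, ha]
      congr 1
      push_cast at hNc ⊢
      field_simp
      ring
    have h2 : (η ^ j) ^ (2 * n + 1) = 1 := by
      rw [← pow_mul, mul_comm, pow_mul, hζ.pow_eq_one, one_pow]
    have h3 : exp (-a * I) * exp (a * I) = 1 := by
      rw [← exp_add]; simp
    have h4 : 2 * Complex.cos a = exp (-a * I) * (w * η ^ j + 1) := by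
      rw [h1, Complex.two_cos, mul_add, pow_two, ← mul_assoc, h3]; ring
    have h5 : w ^ n * exp (-a * I) ^ (2 * n) = (η ^ j) ^ (n + 1) := by
      have h6 : exp (-a * I) ^ 2 * (w * η ^ j) = 1 := by
        rw [h1, ← mul_pow, h3, one_pow]
      calc w ^ n * exp (-a * I) ^ (2 * n)
          = w ^ n * exp (-a * I) ^ (2 * n) * (η ^ j) ^ (2 * n + 1) := by rw [h2, mul_one]
        _ = (exp (-a * I) ^ 2 * (w * η ^ j)) ^ n * (η ^ j) ^ (n + 1) := by ring
        _ = _ := by rw [h6, one_pow, one_mul]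
    calc _ = w ^ n * (2 * Complex.cos a) ^ (2 * n) := by ring
      _ = _ := by rw [h4, mul_pow, ← h5]; ring
  have hgeom : ∀ k ∈ Finset.range (2 * n + 1), k ≠ n →
      ∑ j ∈ Finset.range (2 * n + 1), (η ^ (k + n + 1)) ^ j = 0 := by
    intro k hk hkn
    have hne : η ^ (k + n + 1) ≠ 1 := by
      rw [Ne, hζ.pow_eq_one_iff_dvd]
      rintro ⟨c, hc⟩
      have hk' := Finset.mem_range.1 hk
      rcases c with _ | _ | c
      · omega
      · omega
      · nlinarith
    rw [geom_sum_eq hne, ← pow_mul, mul_comm, pow_mul, hζ.pow_eq_one, one_pow, sub_self, zero_div]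
  rw [eq_div_iff (pow_ne_zero _ two_ne_zero)]
  have hwn : w ^ n ≠ 0 := pow_ne_zero _ hw0
  refine mul_right_cancel₀ hwn ?_
  calc _ = ∑ j ∈ Finset.range (2 * n + 1), (η ^ j) ^ (n + 1) * (w * η ^ j + 1) ^ (2 * n) := by
        rw [mul_assoc, Finset.sum_mul]
        refine Finset.sum_congr rfl fun j _ => ?_
        rw [← hcos j]; ring
    _ = ∑ k ∈ Finset.range (2 * n + 1), ((2 * n).choose k : ℂ) * w ^ k *
          ∑ j ∈ Finset.range (2 * n + 1), (η ^ (k + n + 1)) ^ j := by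
        simp only [add_pow, one_pow, mul_one, Finset.mul_sum]
        rw [Finset.sum_comm]
        refine Finset.sum_congr rfl fun k _ => Finset.sum_congr rfl fun j _ => ?_
        ring
    _ = _ := by
        rw [Finset.sum_eq_single n (fun k hk hkn => by rw [hgeom k hk hkn, mul_zero])
          (fun h => absurd (Finset.mem_range.2 (by omega)) h)]
        have : η ^ (n + n + 1) = 1 := by rw [← two_mul, hζ.pow_eq_one]
        simp only [this, one_pow, Finset.sum_const, Finset.card_range, nsmul_eq_mul]
        push_cast
        ring

/-- The even power `cos (x / 2) ^ (2n)` is a trigonometric polynomial of degree `n`, so its mean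
over `2n + 1` equidistant points is its constant term. -/
theorem sum_cos_pow (n : ℕ) (x : ℝ) :
    ∑ j ∈ Finset.range (2 * n + 1),
      Real.cos ((x - 2 * Real.pi * j / (2 * n + 1)) / 2) ^ (2 * n) =
      (2 * n + 1) * ((2 * n).choose n : ℝ) / 2 ^ (2 * n) := by
  have := sum_cos_pow_complex n x
  apply Complex.ofReal_injective
  push_cast at this ⊢
  exact this

/-! ### Sampling and the variation diminishing property -/

/-- By the mean value theorem, `T n f - α` is a positive multiple of the form with coefficients
`f (v j) - α`, where `v j` is a point of the `j`-th arc. -/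
theorem T_sub_eq {n : ℕ} {f : Circ → ℝ} {v : ℕ → ℝ}
    (hv : ∀ j ∈ Finset.range (2 * n + 1),
      ∫ w in arc n j, f w = 2 * Real.pi / (2 * n + 1) * f (v j : Circ)) (α x : ℝ) :
    T n f (x : Circ) - α = 2 ^ (2 * n) / ((2 * n + 1) * ((2 * n).choose n : ℝ)) *
      cosForm (Finset.range (2 * n + 1)) (fun j => 2 * Real.pi * j / (2 * n + 1))
        (fun j => f (v j : Circ) - α) (2 * n) x := by
  have hN : (0 : ℝ) < 2 * n + 1 := by positivity
  have hC : (0 : ℝ) < ((2 * n).choose n : ℝ) := by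
    exact_mod_cast Nat.choose_pos (by omega)
  have hπ := Real.pi_pos
  have h1 := sum_cos_pow n x
  have h2 : α = 2 ^ (2 * n) / ((2 * n + 1) * ((2 * n).choose n : ℝ)) *
      ∑ j ∈ Finset.range (2 * n + 1),
        α * Real.cos ((x - 2 * Real.pi * j / (2 * n + 1)) / 2) ^ (2 * n) := by
    rw [← Finset.mul_sum, h1]
    field_simp
  conv_lhs => rw [h2]
  rw [T, cosForm, Finset.mul_sum, Finset.mul_sum, ← Finset.sum_sub_distrib]
  refine Finset.sum_congr rfl fun j hj => ?_
  rw [hv j hj, basisDensity_coe]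
  have h3 : (1 + Real.cos (x - 2 * Real.pi * j / (2 * n + 1))) / 2 =
      Real.cos ((x - 2 * Real.pi * j / (2 * n + 1)) / 2) ^ 2 := by
    rw [Real.cos_sq, mul_div_cancel₀ _ (two_ne_zero)]; ring
  rw [h3, ← pow_mul]
  field_simp

theorem cyclicVariation_map_le_cycVar (g : Circ → ℝ) (L : List ℝ) (hL : L.Pairwise (· < ·))
    (h2 : 2 ≤ L.length) (hmem : ∀ x ∈ L, x ∈ Set.Ico 0 (2 * Real.pi)) :
    (cyclicVariation (L.map fun x : ℝ => g (x : Circ)) : ℕ∞) ≤ cycVar g := by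
  have h : L.map (fun x : ℝ => g (x : Circ)) = List.ofFn fun i => g (L.get i : Circ) := by
    conv_lhs => rw [← List.ofFn_get L, List.map_ofFn]
    rfl
  rw [h, cycVar]
  refine le_iSup₂_of_le L.length h2 (le_iSup₂_of_le L.get ?_ (le_iSup_of_le ?_ le_rfl))
  · intro i j hij
    exact List.pairwise_iff_getElem.1 hL _ _ _ _ hij
  · exact fun i => hmem _ (List.getElem_mem _)

/-- Sampling a function at one point of each arc does not increase its cyclic variation. The arc
with `j = 0` straddles the cut of the circle at `0`. -/
theorem cyclicVariation_arcs_le_cycVar (g : Circ → ℝ) (n : ℕ) (v : ℕ → ℝ)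
    (hv : ∀ j ∈ Finset.range (2 * n + 1), v j ∈ Set.Ico (Real.pi * (2 * j - 1) / (2 * n + 1))
      (Real.pi * (2 * j + 1) / (2 * n + 1))) :
    (cyclicVariation ((List.range (2 * n + 1)).map fun j => g (v j : Circ)) : ℕ∞) ≤
      cycVar g := by
  rcases Nat.eq_zero_or_pos n with rfl | hn
  · simp [cyclicVariation_eq_signChanges, signChanges_singleton]
  have hN : (0 : ℝ) < 2 * n + 1 := by positivity
  have hπ := Real.pi_pos
  have hlt : ∀ i j, i < j → j < 2 * n + 1 → v i < v j := by
    intro i j hij hj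
    refine (hv i (Finset.mem_range.2 (by omega))).2.trans_le
      (le_trans ?_ (hv j (Finset.mem_range.2 hj)).1)
    have : (i : ℝ) + 1 ≤ j := by exact_mod_cast hij
    gcongr
    linarith
  have hpos : ∀ j, 0 < j → j < 2 * n + 1 → 0 ≤ v j := by
    intro j hj hj'
    refine le_trans ?_ (hv j (Finset.mem_range.2 hj')).1
    have : (1 : ℝ) ≤ j := by exact_mod_cast hj
    have : (0 : ℝ) ≤ 2 * j - 1 := by linarith
    positivity
  have hup : ∀ j, j < 2 * n + 1 → v j < 2 * Real.pi := by
    intro j hj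
    refine (hv j (Finset.mem_range.2 hj)).2.trans_le ?_
    rw [div_le_iff₀ hN]
    have : (j : ℝ) + 1 ≤ 2 * n + 1 := by exact_mod_cast hj
    nlinarith
  by_cases h0 : 0 ≤ v 0
  · have := cyclicVariation_map_le_cycVar g ((List.range (2 * n + 1)).map v) ?_ ?_ ?_
    · rwa [List.map_map] at this
    · rw [List.pairwise_map]
      refine (List.pairwise_lt_range (n := 2 * n + 1)).imp_of_mem fun {i j} hi hj hij => ?_
      exact hlt i j hij (List.mem_range.1 hj)
    · simp; omega
    · intro x hx
      obtain ⟨j, hj, rfl⟩ := List.mem_map.1 hx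
      rw [List.mem_range] at hj
      refine ⟨?_, hup j hj⟩
      rcases Nat.eq_zero_or_pos j with rfl | hj0
      · exact h0
      · exact hpos j hj0 hj
  · have hlow := (hv 0 (by simp)).1
    have hone : -(2 * Real.pi) ≤ Real.pi * (2 * (0 : ℕ) - 1) / (2 * n + 1) := by
      rw [le_div_iff₀ hN]
      push_cast
      nlinarith
    have hlast : ∀ j, j < 2 * n + 1 → v j < v 0 + 2 * Real.pi := by
      intro j hj
      refine (hv j (Finset.mem_range.2 hj)).2.trans_le ?_
      have : Real.pi * (2 * j + 1) / (2 * n + 1) ≤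
          Real.pi * (2 * (0 : ℕ) - 1) / (2 * n + 1) + 2 * Real.pi := by
        rw [← sub_le_iff_le_add', ← sub_div, div_le_iff₀ hN]
        have : (j : ℝ) + 1 ≤ 2 * n + 1 := by exact_mod_cast hj
        push_cast
        nlinarith
      linarith
    have := cyclicVariation_map_le_cycVar g
      ((List.range (2 * n)).map (fun j => v (j + 1)) ++ [v 0 + 2 * Real.pi]) ?_ ?_ ?_
    · rw [List.range_succ_eq_map, List.map_cons, ← cyclicVariation_append_singleton]
      simpa [Function.comp_def] using this
    · rw [List.pairwise_append]
      refine ⟨?_, by simp, ?_⟩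
      · rw [List.pairwise_map]
        refine (List.pairwise_lt_range (n := 2 * n)).imp_of_mem fun {i j} hi hj hij => ?_
        have := List.mem_range.1 hj
        exact hlt _ _ (by omega) (by omega)
      · intro x hx y hy
        obtain ⟨j, hj, rfl⟩ := List.mem_map.1 hx
        rw [List.mem_singleton.1 hy]
        have := List.mem_range.1 hj
        exact hlast _ (by omega)
    · simp; omega
    · intro x hx
      rcases List.mem_append.1 hx with hx | hx
      · obtain ⟨j, hj, rfl⟩ := List.mem_map.1 hx
        have := List.mem_range.1 hj
        exact ⟨hpos _ (by omega) (by omega), hup _ (by omega)⟩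
      · rw [List.mem_singleton.1 hx]
        constructor <;> linarith

/-- The variation diminishing property of the kernel `cos ((u - t j) / 2) ^ (2n)`. -/
theorem cyclicVariation_map_cosForm_le (n N : ℕ) (t b : ℕ → ℝ) (c : ℝ)
    (ht : ∀ i j, i < j → j < N → t i < t j) (ht' : ∀ j < N, t j ∈ Set.Ico 0 (2 * Real.pi))
    (L : List ℝ) (hL : L.Pairwise (· < ·)) (hmem : ∀ x ∈ L, x ∈ Set.Ico 0 (2 * Real.pi)) :
    cyclicVariation (L.map fun x => c * cosForm (Finset.range N) t b (2 * n) x) ≤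
      cyclicVariation ((List.range N).map b) := by
  obtain ⟨S, e, hS, he, hSe⟩ := exists_cuts (A := 0) ((List.range N).map fun j => (t j, b j))
    (by
      rw [List.pairwise_map]
      refine (List.pairwise_lt_range (n := N)).imp_of_mem fun {i j} hi hj hij => ?_
      exact ht i j hij (List.mem_range.1 hj))
    (by
      intro q hq
      obtain ⟨j, hj, rfl⟩ := List.mem_map.1 hq
      simpa using ht' j (List.mem_range.1 hj))
  rw [List.map_map, Function.comp_def] at hS
  change S.length = cyclicVariation ((List.range N).map b) at hS
  have h1 := even_cyclicVariation (L.map fun x => c * cosForm (Finset.range N) t b (2 * n) x)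
  have h2 := even_cyclicVariation ((List.range N).map b)
  have halt := alternates_cyclicVariation (fun x => c * cosForm (Finset.range N) t b (2 * n) x) L
    hL (s := 0) (by simpa using hmem)
  -- Both variations are even, so a failure of the inequality means an excess of at least two.
  by_contra! hlt
  generalize cyclicVariation (L.map fun x => c * cosForm (Finset.range N) t b (2 * n) x) = k
    at h1 halt hlt
  rw [Nat.even_iff] at h1 h2
  refine not_alternates_cosForm (Finset.range N) t (2 * n) (S.map (· - Real.pi))
    (fun j => e * b j) k 0 (fun j hj => ?_) ?_ ?_ ?_ ?_
  · have := hSe (t j, b j) (List.mem_map.2 ⟨j, List.mem_range.2 (Finset.mem_range.1 hj), rfl⟩)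
    rw [List.map_map]
    convert this using 4
    ext s
    simp only [Function.comp_apply]
    rw [← Real.cos_sub_pi_div_two]
    congr 1
    ring
  · rw [List.length_map, hS]; omega
  · rw [Nat.even_iff]; omega
  · rw [List.length_map, hS, Nat.even_iff]; omega
  · obtain ⟨e', z, hz, hs, hsign⟩ := halt
    refine ⟨e' * c * e, z, hz, hs, fun i hi => ?_⟩
    have h3 : cosForm (Finset.range N) t (fun j => e * b j) (2 * n) (z i) =
        e * cosForm (Finset.range N) t b (2 * n) (z i) := by
      simp only [cosForm, Finset.mul_sum, mul_assoc]
    rw [h3]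
    have := mul_pos (hsign i hi) (mul_self_pos.2 he)
    linarith

end DVP

theorem proposition3p2 (n : ℕ) (f : DVP.Circ → ℝ) (hf : DVP.IsDensity f)
    (hcont : ∀ j ∈ Finset.range (2 * n + 1), ContinuousOn f (DVP.arc n j))
    (α : ℝ) (hα : 0 < α) :
    DVP.cycVar (fun u => DVP.T n f u - α) ≤ DVP.cycVar (fun u => f u - α) := by
  have hN : (0 : ℝ) < 2 * n + 1 := by positivity
  have hπ := Real.pi_pos
  have hmean : ∀ j : ℕ, ∃ v : ℝ, j ∈ Finset.range (2 * n + 1) →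
      v ∈ Set.Ico (Real.pi * (2 * j - 1) / (2 * n + 1)) (Real.pi * (2 * j + 1) / (2 * n + 1)) ∧
      ∫ w in DVP.arc n j, f w = 2 * Real.pi / (2 * n + 1) * f (v : DVP.Circ) := by
    intro j
    by_cases hj : j ∈ Finset.range (2 * n + 1)
    · obtain ⟨v, h1, h2⟩ := DVP.exists_setIntegral_arc_eq hf.integrable.integrableOn (hcont j hj)
      exact ⟨v, fun _ => ⟨h1, h2⟩⟩
    · exact ⟨0, fun h => absurd h hj⟩
  choose v hv using hmean
  refine iSup₂_le fun m _ => iSup₂_le fun x hx => iSup_le fun hx' => ?_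
  refine le_trans ?_
    (DVP.cyclicVariation_arcs_le_cycVar (fun u => f u - α) n v fun j hj => (hv j hj).1)
  have h := DVP.cyclicVariation_map_cosForm_le n (2 * n + 1)
    (fun j => 2 * Real.pi * j / (2 * n + 1)) (fun j => f (v j : DVP.Circ) - α)
    (2 ^ (2 * n) / ((2 * n + 1) * ((2 * n).choose n : ℝ)))
    (fun i j hij _ => by
      have : (i : ℝ) < j := by exact_mod_cast hij
      gcongr)
    (fun j hj => ⟨by positivity, by
      rw [div_lt_iff₀ hN]
      have : (j : ℝ) < 2 * n + 1 := by exact_mod_cast hj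
      gcongr⟩)
    (List.ofFn x) (List.pairwise_ofFn.2 fun i j hij => hx hij)
    (fun y hy => by
      obtain ⟨i, rfl⟩ := (List.mem_ofFn' _ _).1 hy
      exact hx' i)
  simp only [← DVP.T_sub_eq (fun j hj => (hv j hj).2), List.map_ofFn, Function.comp_def] at h
  exact_mod_cast h
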